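/- Let $(\alpha_i)_{i\in I}$ be a family of ordinals indexed by an arbitrary set $I$. Then there are at most finitely many ordinals $\gamma$ that are left-finite and almost piecewise convex mixed sums of $(\alpha_i)_{i\in I}$, that is, for which there exist pairwise disjoint subsets $A_i\subseteq\gamma$ $(i\in I)$, where $\gamma$ is identified with the set of smaller ordinals, such that 1. $\bigcup_{i\in I}A_i=\gamma$ and, for every $i\in I$, $A_i$ has order type $\alpha_i$ in the order induced by $\gamma$; 2. (left-finite) for every $\delta<\gamma$, the set $\{i\in I : A_i\cap\delta\neq\emptyset\}$ is finite; 3. (almost piecewise convex) for all but finitely many $i\in I$, the set $A_i$ is convex in $\gamma$, i.e. whenever $a<a'$ are in $A_i$, every $\delta$ with $a\le\delta\le a'$ belongs to $A_i$. -/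

import Mathlib

universe u v

/-- The ordinal `γ`, regarded as the well-ordered set of its predecessors `γ.ToType`, is a mixed sum
of the family of ordinals `α`, realized by the family `A` of subsets of `γ`: the sets `A i` are
pairwise disjoint, they cover `γ`, and each `A i` has order type `α i` in the induced order. -/
structure IsRealization {I : Type v} (α : I → Ordinal.{u}) (γ : Ordinal.{u})
    (A : I → Set γ.ToType) : Prop where
  pairwise_disjoint : Pairwise fun i j => Disjoint (A i) (A j)
  iUnion_eq : ⋃ i, A i = Set.univ
  type_eq : ∀ i, Ordinal.type (fun x y : A i => x < y) = α i

/-- For every `δ < γ`, only finitely many of the sets `A i` meet the set of predecessors of `δ`. -/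
def IsLeftFinite {I : Type v} {γ : Ordinal.{u}} (A : I → Set γ.ToType) : Prop :=
  ∀ δ : γ.ToType, {i | (A i ∩ Set.Iio δ).Nonempty}.Finite

/-- All but finitely many of the sets `A i` are convex in `γ`. -/
def IsAlmostPiecewiseConvex {I : Type v} {γ : Ordinal.{u}} (A : I → Set γ.ToType) : Prop :=
  {i | ¬ (A i).OrdConnected}.Finite

/-- `γ` is a left-finite and almost piecewise convex mixed sum of `α`: a single realization
has both properties. -/
def IsLeftFiniteAlmostPwConvexMixedSum {I : Type v} (α : I → Ordinal.{u})
    (γ : Ordinal.{u}) : Prop :=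
  ∃ A : I → Set γ.ToType, IsRealization α γ A ∧ IsLeftFinite A ∧ IsAlmostPiecewiseConvex A

/-! Take the least `b` such that only finitely many `α i` are at least `ω ^ b`. The union of those
large pieces has a type `u` from a finite list depending only on `α` (`finite_unionTypes`). For `e <
b` infinitely many pieces have type at least `ω ^ e`, and they fill every nonempty final segment, so
`γ` is a multiple of `ω ^ b` (`opow_dvd_otype_univ`). A proper initial segment meets only finitely
many small pieces, whose union stays below `ω ^ b`; hence `u` determines `γ` up to two values
(`otype_univ_eq_or`). -/

/-- The order type of a subset of a well-ordered type. -/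
noncomputable def otype {X : Type u} [LinearOrder X] [WellFoundedLT X] (S : Set X) : Ordinal.{u} :=
  Ordinal.type (fun x y : S => x < y)

/-! ### Order types of subsets, cut at final segments -/

section OrderType

variable {X : Type u} [LinearOrder X] [WellFoundedLT X]

theorem otype_mono {S T : Set X} (h : S ⊆ T) : otype S ≤ otype T :=
  Ordinal.type_mono h

theorem otype_eq_zero {S : Set X} : otype S = 0 ↔ S = ∅ := by
  rw [otype, Ordinal.type_eq_zero_iff_isEmpty, Set.isEmpty_coe_sort]

theorem otype_univ : otype (Set.univ : Set X) = Ordinal.type (fun x y : X => x < y) :=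
  Ordinal.type_eq.2 ⟨⟨Equiv.Set.univ X, Iff.rfl⟩⟩

open Classical in
theorem otype_union_of_lt {S T : Set X} (h : ∀ s ∈ S, ∀ t ∈ T, s < t) :
    otype (S ∪ T) = otype S + otype T := by
  have hd : Disjoint S T := Set.disjoint_left.2 fun x hS hT => (h x hS x hT).false
  rw [otype, otype, otype, ← Ordinal.type_sum_lex]
  refine Ordinal.type_eq.2 ⟨⟨Equiv.Set.union hd, ?_⟩⟩
  rintro ⟨x, hx | hx⟩ ⟨y, hy | hy⟩
  · simp [Equiv.Set.union_apply_left hd (a := ⟨x, Or.inl hx⟩) hx,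
      Equiv.Set.union_apply_left hd (a := ⟨y, Or.inl hy⟩) hy]
    exact Iff.rfl
  · simp [Equiv.Set.union_apply_left hd (a := ⟨x, Or.inl hx⟩) hx,
      Equiv.Set.union_apply_right hd (a := ⟨y, Or.inr hy⟩) hy]
    exact h x hx y hy
  · simp [Equiv.Set.union_apply_right hd (a := ⟨x, Or.inr hx⟩) hx,
      Equiv.Set.union_apply_left hd (a := ⟨y, Or.inl hy⟩) hy]
    exact (h y hy x hx).le
  · simp [Equiv.Set.union_apply_right hd (a := ⟨x, Or.inr hx⟩) hx,
      Equiv.Set.union_apply_right hd (a := ⟨y, Or.inr hy⟩) hy]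
    exact Iff.rfl

theorem otype_eq_add_of_isUpperSet {R : Set X} (hR : IsUpperSet R) (S : Set X) :
    otype S = otype (S \ R) + otype (S ∩ R) := by
  rw [← otype_union_of_lt, Set.sdiff_union_inter]
  rintro s ⟨-, hs⟩ t ⟨-, ht⟩
  exact lt_of_not_ge fun hts => hs (hR hts ht)

theorem exists_otype_inter_Iio_eq {S : Set X} {o : Ordinal.{u}} (h : o < otype S) :
    ∃ x ∈ S, otype (S ∩ Set.Iio x) = o := by
  obtain ⟨a, ha⟩ := Ordinal.typein_surj (fun x y : S => x < y) h
  refine ⟨a, a.2, ?_⟩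
  rw [← ha, ← Ordinal.type_subrel]
  refine Ordinal.type_eq.2 ⟨⟨⟨fun y => ⟨⟨y.1, y.2.1⟩, y.2.2⟩, fun y => ⟨y.1.1, y.1.2, y.2⟩,
    fun _ => rfl, fun _ => rfl⟩, Iff.rfl⟩⟩

theorem exists_isUpperSet_of_otype_eq_add {S : Set X} {a b : Ordinal.{u}} (h : otype S = a + b) :
    ∃ R : Set X, IsUpperSet R ∧ otype (S \ R) = a ∧ otype (S ∩ R) = b := by
  rcases eq_or_ne b 0 with rfl | hb
  · exact ⟨∅, isUpperSet_empty, by simpa using h, by simp [otype_eq_zero]⟩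
  · have hlt : a < otype S := by
      rw [h]; exact lt_add_of_pos_right a (pos_iff_ne_zero.2 hb)
    obtain ⟨x, -, hx⟩ := exists_otype_inter_Iio_eq hlt
    have hx' : otype (S \ Set.Ici x) = a := by rw [← hx, Set.sdiff_eq, Set.compl_Ici]
    refine ⟨Set.Ici x, isUpperSet_Ici x, hx', ?_⟩
    have := otype_eq_add_of_isUpperSet (isUpperSet_Ici x) S
    rw [h, hx'] at this
    exact (add_left_cancel this).symm

theorem exists_isUpperSet_of_le_otype {S : Set X} {a : Ordinal.{u}} (h : a ≤ otype S) :
    ∃ R : Set X, IsUpperSet R ∧ otype (S \ R) = a ∧ a + otype (S ∩ R) = otype S := by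
  obtain ⟨R, hR, h₁, h₂⟩ :=
    exists_isUpperSet_of_otype_eq_add (Ordinal.add_sub_cancel_of_le h).symm
  exact ⟨R, hR, h₁, by rw [h₂, Ordinal.add_sub_cancel_of_le h]⟩

end OrderType

open Ordinal

theorem opow_mul_natCast_add_one (b : Ordinal.{u}) (n : ℕ) :
    ω ^ b * ((n + 1 : ℕ) : Ordinal) = ω ^ b + ω ^ b * n := by
  rw [add_comm n 1, Nat.cast_add, Nat.cast_one, mul_add, mul_one]

/-! ### Unions compared with multiples of powers of `ω` -/

section Union

variable {X : Type u} [LinearOrder X] [WellFoundedLT X]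

/-- Cut off the initial segment of type `ω ^ b` from the union. By `hb`, one of `S`, `T` contributes
at least `ω ^ b` to it, so its multiple drops by one on the rest. -/
theorem otype_union_lt_mul_of_forall {b : Ordinal.{u}}
    (hb : ∀ S T : Set X, otype S < ω ^ b → otype T < ω ^ b → otype (S ∪ T) < ω ^ b) (k : ℕ) :
    ∀ (m n : ℕ) (S T : Set X), m + n = k → otype S < ω ^ b * (m + 1 : ℕ) →
      otype T < ω ^ b * (n + 1 : ℕ) → otype (S ∪ T) < ω ^ b * (k + 1 : ℕ) := by
  induction k with
  | zero =>
    intro m n S T hmn hS hT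
    obtain ⟨rfl, rfl⟩ : m = 0 ∧ n = 0 := by omega
    simp only [zero_add, Nat.cast_one, mul_one] at hS hT ⊢
    exact hb S T hS hT
  | succ k ih =>
    have key : ∀ (m n : ℕ) (S T : Set X) (R : Set X), IsUpperSet R → m + n = k + 1 →
        otype S < ω ^ b * (m + 1 : ℕ) → otype T < ω ^ b * (n + 1 : ℕ) →
        ω ^ b ≤ otype (S \ R) → otype ((S ∪ T) ∩ R) < ω ^ b * (k + 1 : ℕ) := by
      intro m n S T R hR hmn hS hT hSR
      have h₁ : otype (S ∩ R) < ω ^ b * m := by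
        rw [opow_mul_natCast_add_one, otype_eq_add_of_isUpperSet hR] at hS
        exact lt_of_add_lt_add_left ((add_le_add_left hSR _).trans_lt hS)
      obtain _ | m := m
      · simp at h₁
      · rw [Set.union_inter_distrib_right]
        exact ih m n _ _ (by omega) h₁ ((otype_mono Set.inter_subset_left).trans_lt hT)
    intro m n S T hmn hS hT
    by_contra! hlt
    rw [opow_mul_natCast_add_one] at hlt
    obtain ⟨R, hR, h₁, h₂⟩ := exists_isUpperSet_of_le_otype (le_self_add.trans hlt)
    rw [← h₂] at hlt
    have hge := le_of_add_le_add_left hlt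
    rcases lt_or_ge (otype (S \ R)) (ω ^ b) with hS' | hS'
    · rcases lt_or_ge (otype (T \ R)) (ω ^ b) with hT' | hT'
      · have := hb _ _ hS' hT'
        rw [← Set.union_sdiff_distrib, h₁] at this
        exact this.false
      · have := key n m T S R hR (by omega) hT hS hT'
        rw [Set.union_comm] at this
        exact hge.not_gt this
    · exact hge.not_gt (key m n S T R hR hmn hS hT hS')

theorem otype_union_lt_opow {S T : Set X} {c : Ordinal.{u}} (hS : otype S < ω ^ c)
    (hT : otype T < ω ^ c) : otype (S ∪ T) < ω ^ c := by
  induction c using WellFoundedLT.induction generalizing S T with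
  | ind c ih =>
  rcases eq_or_ne c 0 with rfl | hc
  · rw [opow_zero, Order.lt_one_iff, otype_eq_zero] at hS hT ⊢
    simp [hS, hT]
  · obtain ⟨d₁, hd₁, m, hm⟩ := (lt_omega0_opow hc).1 hS
    obtain ⟨d₂, hd₂, n, hn⟩ := (lt_omega0_opow hc).1 hT
    have hd : max d₁ d₂ < c := max_lt hd₁ hd₂
    have mono : ∀ {d : Ordinal.{u}} (k : ℕ), d ≤ max d₁ d₂ →
        ω ^ d * (k : Ordinal) ≤ ω ^ max d₁ d₂ * ((k + 1 : ℕ) : Ordinal) := fun k h =>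
      mul_le_mul' (opow_le_opow_right omega0_pos h) (Nat.cast_le.2 k.le_succ)
    refine (lt_omega0_opow hc).2 ⟨_, hd, m + n + 1, ?_⟩
    exact otype_union_lt_mul_of_forall (fun S T => ih _ hd) _ m n S T rfl
      (hm.trans_le (mono m (le_max_left _ _))) (hn.trans_le (mono n (le_max_right _ _)))

theorem otype_biUnion_lt_opow {ι : Type v} {A : ι → Set X} {c : Ordinal.{u}} {s : Set ι}
    (hs : s.Finite) (h : ∀ i ∈ s, otype (A i) < ω ^ c) : otype (⋃ i ∈ s, A i) < ω ^ c := by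
  induction s, hs using Set.Finite.induction_on with
  | empty => simpa [otype_eq_zero.2] using opow_pos c omega0_pos
  | insert _ _ ih =>
    rw [Set.biUnion_insert]
    exact otype_union_lt_opow (h _ (Set.mem_insert _ _))
      (ih fun i hi => h i (Set.mem_insert_of_mem _ hi))

theorem otype_biUnion_lt_opow_mul {ι : Type v} {A : ι → Set X} {b : Ordinal.{u}} {m : ι → ℕ}
    (h : ∀ i, otype (A i) < ω ^ b * (m i + 1 : ℕ)) (s : Finset ι) :
    otype (⋃ i ∈ s, A i) < ω ^ b * (∑ i ∈ s, m i + 1 : ℕ) := by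
  classical
  induction s using Finset.induction_on with
  | empty => simpa [otype_eq_zero.2] using opow_pos b omega0_pos
  | insert a s ha ih =>
    rw [Finset.set_biUnion_insert, Finset.sum_insert ha]
    exact otype_union_lt_mul_of_forall (fun S T => otype_union_lt_opow) _ _ _ _ _ rfl (h a) ih

/-- Removing a set of order type less than `ω ^ b` preserves lower bounds that are multiples of
`ω ^ b`. -/
theorem opow_mul_le_otype_of_union {b : Ordinal.{u}} (p : Ordinal.{u}) :
    ∀ {S V : Set X}, otype V < ω ^ b → ω ^ b * p ≤ otype (S ∪ V) → ω ^ b * p ≤ otype S := by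
  induction p using Ordinal.limitRecOn with
  | zero => simp
  | add_one p ih =>
    intro S V hV h
    rw [mul_add_one] at h ⊢
    obtain ⟨R, hR, h₁, h₂⟩ := exists_isUpperSet_of_le_otype (le_self_add.trans h)
    rw [← h₂] at h
    have hge := le_of_add_le_add_left h
    rw [otype_eq_add_of_isUpperSet hR]
    refine add_le_add (ih ((otype_mono Set.sdiff_subset).trans_lt hV)
      (by rw [← Set.union_sdiff_distrib, h₁])) ?_
    by_contra! hlt
    refine hge.not_gt ?_
    rw [Set.union_inter_distrib_right]
    exact otype_union_lt_opow hlt ((otype_mono Set.inter_subset_left).trans_lt hV)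
  | limit p hp ih =>
    intro S V hV h
    exact (mul_le_iff_of_isSuccLimit hp).2 fun p' hp' =>
      ih p' hp' hV ((mul_le_mul_right hp'.le _).trans h)

theorem opow_mul_card_le_otype_biUnion {ι : Type v} {A : ι → Set X} {e : Ordinal.{u}}
    (hd : Pairwise fun i j => Disjoint (A i) (A j)) (s : Finset ι)
    (hconv : ∀ i ∈ s, (A i).OrdConnected) (h : ∀ i ∈ s, ω ^ e ≤ otype (A i)) :
    ω ^ e * (s.card : Ordinal) ≤ otype (⋃ i ∈ s, A i) := by
  classical
  have hne : ∀ i ∈ s, (A i).Nonempty := fun i hi => by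
    rw [Set.nonempty_iff_ne_empty, ne_eq, ← otype_eq_zero]
    exact ((opow_pos e omega0_pos).trans_le (h i hi)).ne'
  -- Disjoint convex sets are ordered like any choice of representatives; `⊥` is a dummy outside
  -- `s`.
  have : ∀ i, ∃ x : WithBot X, i ∈ s → ∃ y ∈ A i, x = y := fun i => by
    by_cases hi : i ∈ s
    · exact ⟨_, fun _ => ⟨_, (hne i hi).some_mem, rfl⟩⟩
    · exact ⟨⊥, fun h => absurd h hi⟩
  choose x hx using this
  clear hne
  induction s using Finset.induction_on_max_value x with
  | empty => simp
  | insert a s has hmax ih =>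
    rw [Finset.card_insert_of_notMem has, Finset.set_biUnion_insert, Set.union_comm,
      otype_union_of_lt, Nat.cast_add_one, mul_add_one]
    · exact add_le_add (ih (fun i hi => hconv i (Finset.mem_insert_of_mem hi))
        (fun i hi => h i (Finset.mem_insert_of_mem hi))
        (fun i hi => hx i (Finset.mem_insert_of_mem hi))) (h a (Finset.mem_insert_self a s))
    · intro y hy z hz
      obtain ⟨j, hj, hyj⟩ := Set.mem_iUnion₂.1 hy
      have hja : Disjoint (A j) (A a) := hd fun e => has (e ▸ hj)
      obtain ⟨p, hp, hpx⟩ := hx j (Finset.mem_insert_of_mem hj)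
      obtain ⟨q, hq, hqx⟩ := hx a (Finset.mem_insert_self a s)
      have hpq : p ≤ q := by simpa [hpx, hqx] using hmax j hj
      by_contra! hzy
      rcases le_total p z with hle | hle
      · exact Set.disjoint_left.1 hja
          ((hconv j (Finset.mem_insert_of_mem hj)).out hp hyj ⟨hle, hzy⟩) hz
      · exact Set.disjoint_left.1 hja hp
          ((hconv a (Finset.mem_insert_self a s)).out hz hq ⟨hle, hpq⟩)

end Union

/-! ### Types of finite unions -/

/-- A larger right summand forces a smaller left one, so the set is well-ordered in both directions.
-/
theorem finite_setOf_add_eq (a : Ordinal.{u}) : {r : Ordinal.{u} | ∃ l, l + r = a}.Finite := by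
  have h : ∀ r : {r : Ordinal.{u} | ∃ l, l + r = a}, ∃ l, l + r.1 = a := fun r => r.2
  choose f hf using h
  have hanti : StrictAnti f := fun r r' hr => by
    by_contra! hle
    have := (add_lt_add_right (α := Ordinal) (show r.1 < r'.1 from hr) (f r)).trans_le
      (add_le_add_left hle r'.1)
    rw [hf, hf] at this
    exact this.false
  have : WellFoundedGT {r : Ordinal.{u} | ∃ l, l + r = a} := hanti.wellFoundedGT
  exact Finite.of_wellFoundedLT_wellFoundedGT _

/-- The order types of the unions of sets with prescribed order types in a well-ordered type. -/
def unionTypes {ι : Type v} (α : ι → Ordinal.{u}) : Set Ordinal.{u} :=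
  {o | ∃ (X : Type u) (_ : LinearOrder X) (_ : WellFoundedLT X) (A : ι → Set X),
    (∀ i, otype (A i) = α i) ∧ otype (⋃ i, A i) = o}

/-- Divide the type of the union by `ω ^ c` for a suitable `c < b`: the quotient is a bounded
natural number, and the remainder is a union of final parts of the pieces, which have finitely many
possible types, all below `ω ^ c`. -/
theorem finite_unionTypes_of_lt_opow {ι : Type v} [Finite ι] (b : Ordinal.{u}) :
    ∀ α : ι → Ordinal.{u}, (∀ i, α i < ω ^ b) → (unionTypes α).Finite := by
  induction b using WellFoundedLT.induction with
  | ind b ih =>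
  intro α hα
  rcases eq_or_ne b 0 with rfl | hb
  · refine (Set.finite_singleton 0).subset ?_
    rintro o ⟨X, _, _, A, hA, rfl⟩
    have : ∀ i, A i = ∅ := fun i => by
      rw [← otype_eq_zero, hA, ← Order.lt_one_iff, ← opow_zero ω]; exact hα i
    simp [this, otype_eq_zero]
  have := Fintype.ofFinite ι
  have hc : ∃ c < b, ∃ m : ι → ℕ, ∀ i, α i < ω ^ c * (m i + 1 : ℕ) := by
    choose d hd m hm using fun i => (lt_omega0_opow hb).1 (hα i)
    refine ⟨Finset.univ.sup d, (Finset.sup_lt_iff (pos_iff_ne_zero.2 hb)).2 fun i _ => hd i, m,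
      fun i => (hm i).trans_le ?_⟩
    exact mul_le_mul' (opow_le_opow_right omega0_pos (Finset.le_sup (Finset.mem_univ i)))
      (Nat.cast_le.2 (m i).le_succ)
  obtain ⟨c, hcb, m, hm⟩ := hc
  have hpos : (ω ^ c : Ordinal.{u}) ≠ 0 := (opow_pos c omega0_pos).ne'
  have hfin : {β : ι → Ordinal.{u} | (∀ i, ∃ l, l + β i = α i) ∧ ∀ i, β i < ω ^ c}.Finite :=
    (Set.Finite.pi' fun i => finite_setOf_add_eq (α i)).subset fun β hβ => hβ.1
  refine (Set.Finite.biUnion (Set.finite_Iio (∑ i, m i + 1)) fun k _ =>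
    hfin.biUnion fun β hβ => (ih c hcb β hβ.2).image fun r => ω ^ c * (k : Ordinal) + r).subset ?_
  rintro o ⟨X, _, _, A, hA, rfl⟩
  set U := ⋃ i, A i with hU
  have hlt : otype U < ω ^ c * (∑ i, m i + 1 : ℕ) := by
    have := otype_biUnion_lt_opow_mul (A := A) (b := c) (m := m)
      (fun i => by rw [hA]; exact hm i) Finset.univ
    simpa [hU] using this
  have hq : otype U / ω ^ c < (∑ i, m i + 1 : ℕ) := (lt_mul_iff_div_lt hpos).1 hlt
  obtain ⟨k, hk⟩ := lt_omega0.1 (hq.trans (natCast_lt_omega0 _))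
  rw [hk, Nat.cast_lt] at hq
  obtain ⟨R, hR, h₁, h₂⟩ :=
    exists_isUpperSet_of_otype_eq_add (div_add_mod (otype U) (ω ^ c)).symm
  have hr : otype (U ∩ R) < ω ^ c := by rw [h₂]; exact mod_lt _ hpos
  simp only [Set.mem_iUnion, Set.mem_image]
  refine ⟨k, hq, fun i => otype (A i ∩ R), ⟨fun i => ⟨otype (A i \ R), ?_⟩, fun i => ?_⟩,
    otype (U ∩ R), ⟨X, _, _, fun i => A i ∩ R, fun _ => rfl, ?_⟩, ?_⟩
  · rw [← otype_eq_add_of_isUpperSet hR, hA]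
  · exact (otype_mono (Set.inter_subset_inter_left R (Set.subset_iUnion A i))).trans_lt hr
  · rw [hU, Set.iUnion_inter]
  · rw [h₂, ← hk, div_add_mod]

theorem finite_unionTypes {ι : Type v} [Finite ι] (α : ι → Ordinal.{u}) :
    (unionTypes α).Finite := by
  obtain ⟨b, hb⟩ := (Set.finite_range α).bddAbove
  refine finite_unionTypes_of_lt_opow (Order.succ b) α fun i => ?_
  exact (Order.lt_succ_of_le (hb ⟨i, rfl⟩)).trans_le (right_le_opow _ one_lt_omega0)

/-! ### Left-finite sums -/

section LeftFinite

variable {X : Type u} [LinearOrder X] [WellFoundedLT X] {I : Type v} {A : I → Set X}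
  {b : Ordinal.{u}}

theorem opow_dvd_otype_univ (hd : Pairwise fun i j => Disjoint (A i) (A j))
    (hleft : ∀ δ : X, {i | (A i ∩ Set.Iio δ).Nonempty}.Finite)
    (hconv : {i | ¬ (A i).OrdConnected}.Finite)
    (hinf : ∀ e < b, {i | ω ^ e ≤ otype (A i)}.Infinite) :
    ω ^ b * (otype (Set.univ : Set X) / ω ^ b) = otype (Set.univ : Set X) := by
  have hpos : (ω ^ b : Ordinal.{u}) ≠ 0 := (opow_pos b omega0_pos).ne'
  set g := otype (Set.univ : Set X)
  suffices hr : g % ω ^ b = 0 by simpa [hr] using div_add_mod g (ω ^ b)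
  by_contra hr
  obtain ⟨R, hR, -, h₂⟩ := exists_isUpperSet_of_otype_eq_add (div_add_mod g (ω ^ b)).symm
  rw [Set.univ_inter] at h₂
  rw [← h₂] at hr
  obtain ⟨x, hx⟩ : R.Nonempty := by
    rwa [Set.nonempty_iff_ne_empty, ne_eq, ← otype_eq_zero]
  have he : log ω (otype R) < b :=
    (lt_opow_iff_log_lt one_lt_omega0 hr).1 (by rw [h₂]; exact mod_lt _ hpos)
  obtain ⟨n, hn⟩ := lt_omega0_opow_succ.1 (lt_opow_succ_log_self one_lt_omega0 (otype R))
  -- Left-finiteness leaves `n` convex pieces of type at least `ω ^ e` avoiding everything below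
  -- `x`, hence inside `R`: too many for its type.
  obtain ⟨s, hs, rfl⟩ :=
    (((hinf _ he).sdiff (hleft x)).sdiff hconv).exists_subset_card_eq n
  refine hn.not_ge ((opow_mul_card_le_otype_biUnion hd s
    (fun i hi => not_not.1 (hs hi).2) fun i hi => (hs hi).1.1).trans
    (otype_mono (Set.iUnion₂_subset fun i hi y hy => ?_)))
  by_contra hyR
  exact (hs hi).1.2 ⟨y, hy, lt_of_not_ge fun hxy => hyR (hR hxy hx)⟩

theorem otype_univ_eq_or (hd : Pairwise fun i j => Disjoint (A i) (A j))
    (hunion : ⋃ i, A i = Set.univ)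
    (hleft : ∀ δ : X, {i | (A i ∩ Set.Iio δ).Nonempty}.Finite)
    (hconv : {i | ¬ (A i).OrdConnected}.Finite)
    (hinf : ∀ e < b, {i | ω ^ e ≤ otype (A i)}.Infinite) {u : Ordinal.{u}}
    (hu : otype (⋃ i : {i | ω ^ b ≤ otype (A i)}, A i) = u) :
    otype (Set.univ : Set X) = ω ^ b * (u / ω ^ b) ∨
      otype (Set.univ : Set X) = ω ^ b * (u / ω ^ b + 1) := by
  have hpos : (ω ^ b : Ordinal.{u}) ≠ 0 := (opow_pos b omega0_pos).ne'
  have hdvd := opow_dvd_otype_univ hd hleft hconv hinf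
  set g := otype (Set.univ : Set X)
  set U := ⋃ i : {i | ω ^ b ≤ otype (A i)}, A i with hU
  have hlow : ∀ p < g / ω ^ b, ω ^ b * p ≤ u := by
    intro p hp
    have hlt : ω ^ b * p < g := mul_lt_of_lt_div hp
    obtain ⟨R, hR, h₁, h₂⟩ := exists_isUpperSet_of_le_otype hlt.le
    obtain ⟨x, hx⟩ : R.Nonempty := by
      rw [Set.nonempty_iff_ne_empty]
      rintro rfl
      rw [Set.inter_empty, otype_eq_zero.2 rfl, add_zero] at h₂
      exact hlt.ne h₂
    set F := {i | (A i ∩ Set.Iio x).Nonempty} \ {i | ω ^ b ≤ otype (A i)} with hF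
    have hV : otype (⋃ i ∈ F, A i) < ω ^ b :=
      otype_biUnion_lt_opow (hleft x).sdiff fun i hi => not_le.1 hi.2
    rw [← hu]
    refine opow_mul_le_otype_of_union p hV ?_
    rw [← h₁]
    refine otype_mono ?_
    rintro y ⟨-, hy⟩
    obtain ⟨i, hi⟩ := Set.mem_iUnion.1 (hunion.ge (Set.mem_univ y))
    by_cases hib : ω ^ b ≤ otype (A i)
    · exact Or.inl (Set.mem_iUnion.2 ⟨⟨i, hib⟩, hi⟩)
    · exact Or.inr (Set.mem_iUnion₂.2
        ⟨i, ⟨⟨y, hi, lt_of_not_ge fun hxy => hy (hR hxy hx)⟩, hib⟩, hi⟩)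
  have hle : u / ω ^ b ≤ g / ω ^ b := div_le_left (hu ▸ otype_mono (Set.subset_univ _)) _
  rcases hle.eq_or_lt with h | h
  · exact Or.inl (by rw [h, hdvd])
  · right
    rcases (Order.add_one_le_of_lt h).eq_or_lt with h' | h'
    · rw [h', hdvd]
    · exact absurd ((mul_le_iff_le_div hpos).1 (hlow _ h')) (lt_add_one _).not_ge

end LeftFinite

theorem theorem5p3 {I : Type v} (α : I → Ordinal.{u}) :
    {γ : Ordinal.{u} | IsLeftFiniteAlmostPwConvexMixedSum α γ}.Finite := by
  by_cases hex : ∃ b : Ordinal.{u}, {i | ω ^ b ≤ α i}.Finite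
  · obtain ⟨b, hb, hmin⟩ := WellFounded.has_min (wellFounded_lt (α := Ordinal.{u})) _ hex
    have : Finite {i | ω ^ b ≤ α i} := hb
    refine ((finite_unionTypes fun i : {i | ω ^ b ≤ α i} => α i).biUnion fun u _ =>
      Set.toFinite {ω ^ b * (u / ω ^ b), ω ^ b * (u / ω ^ b + 1)}).subset ?_
    rintro γ ⟨A, hA, hleft, hconv⟩
    obtain rfl : α = fun i => otype (A i) := funext fun i => (hA.type_eq i).symm
    refine Set.mem_iUnion₂.2 ⟨otype (⋃ i : {i | ω ^ b ≤ otype (A i)}, A i),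
      ⟨γ.ToType, _, inferInstance, fun i => A i, fun _ => rfl, rfl⟩, ?_⟩
    have hγ : otype (Set.univ : Set γ.ToType) = γ := by rw [otype_univ]; exact type_toType γ
    have := otype_univ_eq_or (b := b) hA.pairwise_disjoint hA.iUnion_eq hleft hconv
      (fun e he hfin => hmin e hfin he) rfl
    rwa [hγ] at this
  -- Without such a `b` the `α i` are unbounded, yet each is at most `γ`.
  · refine Set.finite_empty.subset ?_
    rintro γ ⟨A, hA, -, -⟩
    refine hex ⟨Order.succ γ, Set.finite_empty.subset fun i hi => ?_⟩
    have h₁ : α i ≤ γ := by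
      rw [← hA.type_eq i]
      exact (type_set_le (A i)).trans_eq (type_toType γ)
    exact ((Order.lt_succ γ).trans_le (right_le_opow _ one_lt_omega0)).not_ge
      ((show ω ^ Order.succ γ ≤ α i from hi).trans h₁)
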